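/- Let $n\ge 1$ and $k>2$ be integers. For a homogeneous polynomial $V\in\mathbb{C}[q_1,\dots,q_n]$ of degree $k$ let $V'$ denote its gradient and $V''$ its Hessian matrix. A Darboux point of $V$ is a point $[d]\in\mathbb{CP}^{n-1}$, $d\neq 0$, such that $V'(d)\neq 0$ and $V'(d)$ is parallel to $d$; it is represented by vectors $d \ne 0$ normalised so that $V'(d)=d$. The Kovalevskaya exponents of $V$ at such a point are the eigenvalues of the matrix $V''(d)-E$, where $E$ is the identity matrix and $d$ is a normalised representative (they do not depend on the choice of $d$). Let $\mathcal{G}_k$ be the set of all homogeneous polynomials $V$ of degree $k$ such that 1. $V$ has exactly $D(n,k-1):=\dfrac{(k-1)^n-1}{k-2}$ Darboux points, and 2. at each Darboux point of $V$ all the Kovalevskaya exponents are different from zero. Then $\mathcal{G}_k$ contains $V_0=\sum_{i=1}^n q_i^k$, so it is non-empty. Moreover, $\mathcal{G}_k$ is open in the space of homogeneous polynomials of degree $k$, identified through the coefficients with $\mathbb{C}^{N}$, $N=\binom{n+k-1}{k}$, with its usual topology; equivalently, it is open with respect to an arbitrary norm on $\mathbb{C}^{N}$. -/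

import Mathlib

open MvPolynomial
open scoped LinearAlgebra.Projectivization

/-- A polynomial vector field `F = (F_1, …, F_n)` on `ℂⁿ`. -/
abbrev PolyField (n : ℕ) := Fin n → MvPolynomial (Fin n) ℂ

namespace PolyField

/-- The value `F(d) ∈ ℂⁿ`. -/
noncomputable def evalAt {n : ℕ} (F : PolyField n) (d : Fin n → ℂ) : Fin n → ℂ :=
  fun i => eval d (F i)

/-- A direction `d ≠ 0` such that `F(d) ≠ 0` and `F(d)` is parallel to `d`. -/
def IsDarbouxDirection {n : ℕ} (F : PolyField n) (d : Fin n → ℂ) : Prop :=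
  d ≠ 0 ∧ F.evalAt d ≠ 0 ∧ ∃ c : ℂ, F.evalAt d = c • d

/-- The set of Darboux points of `F`, as points of the projective space of `ℂⁿ`. -/
def darbouxPoints {n : ℕ} (F : PolyField n) : Set (ℙ ℂ (Fin n → ℂ)) :=
  {p | ∃ (d : Fin n → ℂ) (hd : d ≠ 0),
    Projectivization.mk ℂ d hd = p ∧ F.IsDarbouxDirection d}

/-- `d` is a normalised representative of the projective point `p`: a nonzero vector on the
line `p` with `F(d) = d`. -/
def IsNormalisedRep {n : ℕ} (F : PolyField n) (p : ℙ ℂ (Fin n → ℂ)) (d : Fin n → ℂ) : Prop :=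
  F.evalAt d = d ∧ ∃ hd : d ≠ 0, Projectivization.mk ℂ d hd = p

/-- The Kovalevskaya matrix `F'(d) - E`, with `F'` the Jacobian matrix
(used at normalised representatives `d` of Darboux points). -/
noncomputable def kovalevskayaMatrix {n : ℕ} (F : PolyField n) (d : Fin n → ℂ) :
    Matrix (Fin n) (Fin n) ℂ :=
  Matrix.of (fun i j => eval d (pderiv j (F i))) - 1

/-- The Kovalevskaya exponents `Λ_1(d), …, Λ_n(d)`: the eigenvalues of the Kovalevskaya matrix,
with multiplicities. -/
noncomputable def kovalevskayaExponents {n : ℕ} (F : PolyField n) (d : Fin n → ℂ) :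
    Multiset ℂ :=
  (F.kovalevskayaMatrix d).charpoly.roots

end PolyField

/-- The number `D(n, k) = (k ^ n - 1) / (k - 1)`. -/
def darbouxNumber (n k : ℕ) : ℕ := (k ^ n - 1) / (k - 1)

/-- The division in `darbouxNumber` is exact. -/
theorem darbouxNumber_mul (n k : ℕ) : darbouxNumber n k * (k - 1) = k ^ n - 1 := by
  refine Nat.div_mul_cancel ?_
  simpa using Nat.sub_dvd_pow_sub_pow k 1 n

/-- The gradient field `V'` of a potential `V ∈ ℂ[q_1, …, q_n]`. -/
noncomputable def gradField {n : ℕ} (V : MvPolynomial (Fin n) ℂ) : PolyField n :=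
  fun i => pderiv i V

/-- The set `𝒢_k` of homogeneous potentials `V` of degree `k` in `n` variables which have
exactly `D(n, k - 1)` Darboux points and all of whose Kovalevskaya exponents, at every
Darboux point, are different from zero. -/
def genericPotentials (n k : ℕ) : Set (MvPolynomial (Fin n) ℂ) :=
  {V | V.IsHomogeneous k ∧
    (gradField V).darbouxPoints.encard = (darbouxNumber n (k - 1) : ℕ∞) ∧
    ∀ p ∈ (gradField V).darbouxPoints, ∀ d : Fin n → ℂ, (gradField V).IsNormalisedRep p d →
      ∀ Λ ∈ (gradField V).kovalevskayaExponents d, Λ ≠ 0}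

/-- Every Darboux point of the gradient field of a homogeneous potential of degree `k > 2`
has a normalised representative. -/
theorem exists_isNormalisedRep {n k : ℕ} (hk : 2 < k) {V : MvPolynomial (Fin n) ℂ}
    (hV : V.IsHomogeneous k) {p : ℙ ℂ (Fin n → ℂ)} (hp : p ∈ (gradField V).darbouxPoints) :
    ∃ d, (gradField V).IsNormalisedRep p d := by
  obtain ⟨d, hd, rfl, -, hne, c, hc⟩ := hp
  have hc0 : c ≠ 0 := by
    rintro rfl
    exact hne (by simpa using hc)
  obtain ⟨a, ha⟩ := IsAlgClosed.exists_pow_nat_eq c⁻¹ (n := k - 2) (by omega)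
  have ha0 : a ≠ 0 := by
    rintro rfl
    rw [zero_pow (by omega)] at ha
    exact inv_ne_zero hc0 ha.symm
  refine ⟨a • d, ?_, smul_ne_zero ha0 hd, ?_⟩
  · funext i
    have h1 : eval (a • d) (pderiv i V) = a ^ (k - 1) * eval d (pderiv i V) := by
      have hh := hV.pderiv (i := i)
      rw [eval_eq, eval_eq, Finset.mul_sum]
      refine Finset.sum_congr rfl fun m hm => ?_
      have hdeg := hh.degree_eq_sum_deg_support hm
      have : ∏ j ∈ m.support, a ^ m j = a ^ (k - 1) := by
        rw [Finset.prod_pow_eq_pow_sum, hdeg]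
      simp only [Pi.smul_apply, smul_eq_mul, mul_pow, Finset.prod_mul_distrib, this]
      ring
    have h2 : eval d (pderiv i V) = c * d i := by
      simpa [PolyField.evalAt, gradField] using congrFun hc i
    have h3 : a ^ (k - 1) = c⁻¹ * a := by
      rw [← ha, ← pow_succ]
      congr 1
      omega
    simp only [PolyField.evalAt, gradField, h1, h2, h3, Pi.smul_apply, smul_eq_mul]
    field_simp
  · rw [Projectivization.mk_eq_mk_iff']
    exact ⟨a, rfl⟩

/-- The exponents of the monomials of degree `k` in `n` variables. -/
abbrev MonomialIndex (n k : ℕ) := {α : Fin n →₀ ℕ // α.degree = k}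

instance MonomialIndex.instFinite (n k : ℕ) : Finite (MonomialIndex n k) := by
  refine Set.Finite.subset (Finset.finite_toSet
    ((Finset.univ : Finset (Fin n)).finsuppAntidiag k)) fun α hα => ?_
  have h : α.degree = k := hα
  simp only [Finset.mem_coe, Finset.mem_finsuppAntidiag, Finset.subset_univ, and_true]
  rw [← h, Finsupp.degree_eq_sum]

noncomputable instance MonomialIndex.instFintype (n k : ℕ) : Fintype (MonomialIndex n k) :=
  Fintype.ofFinite _

/-- The coefficient space `ℂ^d`, one coordinate for each monomial of degree `k`, with its usual
topology. -/
abbrev CoeffSpace (n k : ℕ) := MonomialIndex n k → ℂ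

/-- The potential `V = ∑ v_α q^α` with coefficient vector `v`. -/
noncomputable def potentialOfCoeffs {n k : ℕ} (v : CoeffSpace n k) : MvPolynomial (Fin n) ℂ :=
  ∑ α, monomial α.1 (v α)

theorem potentialOfCoeffs_isHomogeneous {n k : ℕ} (v : CoeffSpace n k) :
    (potentialOfCoeffs v).IsHomogeneous k :=
  IsHomogeneous.sum _ _ _ fun α _ => isHomogeneous_monomial _ α.2

theorem coeff_potentialOfCoeffs {n k : ℕ} (v : CoeffSpace n k) (α : MonomialIndex n k) :
    coeff α.1 (potentialOfCoeffs v) = v α := by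
  classical
  simp [potentialOfCoeffs, coeff_sum, coeff_monomial, Subtype.val_inj]

/-- Every homogeneous polynomial of degree `k` is the potential of its coefficient vector. -/
theorem potentialOfCoeffs_coeff {n k : ℕ} {V : MvPolynomial (Fin n) ℂ} (hV : V.IsHomogeneous k) :
    potentialOfCoeffs (fun α : MonomialIndex n k => coeff α.1 V) = V := by
  ext m
  by_cases hm : m.degree = k
  · exact coeff_potentialOfCoeffs _ (⟨m, hm⟩ : MonomialIndex n k)
  · rw [hV.coeff_eq_zero hm, (potentialOfCoeffs_isHomogeneous _).coeff_eq_zero hm]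

/-! Write `F = V'` and `m = k - 1`. A normalised representative is a nonzero fixed point of `F`, and
by homogeneity each Darboux point carries exactly `k - 2` of them. Adding the origin, where `F' - E
= -E`, one gets: `V ∈ 𝒢_k` iff `F` has exactly `m ^ n` fixed points, all with `F' - E` invertible.
Since `m ^ n` is the Bézout number of `F(x) = x`, membership says that all solutions are simple and
none lies at infinity.

Three facts give openness. Nondegenerate solutions persist under perturbation, so nearby fields have
at least `m ^ n` fixed points. A system has at most `m ^ n` nondegenerate solutions
(`PolyField.card_nondegenerate_zeros_le`, from Perron's algebraic relation and persistence). Nearby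
fields have no degenerate fixed point (`eventually_fixedPoints_nondegenerate`), by compactness of a
sphere in homogenised coordinates.

Compactness requires excluding solutions at infinity, that is, nonzero `d` with `F(d) = 0`
(`PolyField.eq_zero_of_evalAt_eq_zero`). Given such a `d`, a small perturbation along `d` brings the
solution in from infinity as a nondegenerate fixed point near infinity, while the `m ^ n` old ones
survive in a bounded region; this contradicts the Bézout bound. -/

/-! ### Counting lattice points; Perron's algebraic relation -/

/-- The lattice points `a ∈ ℕⁿ` with `∑ a_i ≤ T`. -/
def latticeSimplex (n T : ℕ) : Finset (Fin n → ℕ) :=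
  (Fintype.piFinset fun _ => Finset.range (T + 1)).filter fun a => ∑ i, a i ≤ T

theorem mem_latticeSimplex {n T : ℕ} {a : Fin n → ℕ} :
    a ∈ latticeSimplex n T ↔ ∑ i, a i ≤ T := by
  simp only [latticeSimplex, Finset.mem_filter, Fintype.mem_piFinset, Finset.mem_range,
    and_iff_right_iff_imp]
  intro h i
  have := Finset.single_le_sum (f := a) (fun j _ => Nat.zero_le _) (Finset.mem_univ i)
  omega

theorem card_latticeSimplex_le (n T : ℕ) : (latticeSimplex n T).card ≤ (T + 1) ^ n := by
  refine (Finset.card_filter_le _ _).trans ?_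
  simp

theorem latticeSimplex_card_pos (n T : ℕ) : 0 < (latticeSimplex n T).card :=
  Finset.card_pos.mpr ⟨0, by simp [mem_latticeSimplex]⟩

/-- Division by `m` with remainder in each coordinate is injective, and the vector of quotients lies
in the smaller simplex. -/
theorem card_latticeSimplex_mul_le {n m : ℕ} (hm : 0 < m) (T : ℕ) :
    (latticeSimplex n (m * T)).card ≤ m ^ n * (latticeSimplex n T).card := by
  have h : ((Fintype.piFinset fun _ : Fin n => Finset.range m) ×ˢ latticeSimplex n T).card
      = m ^ n * (latticeSimplex n T).card := by simp
  rw [← h]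
  refine Finset.card_le_card_of_injOn (fun a => (fun i => a i % m, fun i => a i / m)) ?_ ?_
  · intro a ha
    have ha' := mem_latticeSimplex.1 (Finset.mem_coe.1 ha)
    simp only [Finset.coe_product, Set.mem_prod, Finset.mem_coe, Fintype.mem_piFinset,
      Finset.mem_range, mem_latticeSimplex]
    refine ⟨fun i => Nat.mod_lt _ hm, ?_⟩
    refine Nat.le_of_mul_le_mul_left (?_ : m * _ ≤ m * T) hm
    rw [Finset.mul_sum]
    exact (Finset.sum_le_sum fun i _ => Nat.mul_div_le _ _).trans ha'
  · intro a _ b _ hab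
    simp only [Prod.mk.injEq] at hab
    funext i
    rw [← Nat.mod_add_div (a i) m, ← Nat.mod_add_div (b i) m, congrFun hab.1 i, congrFun hab.2 i]

/-- Polynomial growth of the simplices: a bounded enlargement multiplies the number of lattice
points by a factor arbitrarily close to `1`. -/
theorem exists_card_latticeSimplex_add_lt (n A B : ℕ) (hA : 0 < A) :
    ∃ T, A * (latticeSimplex n (T + B)).card < (A + 1) * (latticeSimplex n T).card := by
  -- Otherwise each enlargement by `B` multiplies the count by at least `(A + 1) / A > 1`; this
  -- exponential growth in `j` contradicts the polynomial bound `(j * B + 1) ^ n`.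
  by_contra! h
  set r : ℝ := (A + 1) / A with hr
  have hA' : (0 : ℝ) < A := by exact_mod_cast hA
  have hr1 : 1 < r := by rw [hr, lt_div_iff₀ hA']; linarith
  have hgrow : ∀ j : ℕ, r ^ j ≤ ((latticeSimplex n (j * B)).card : ℝ) := by
    intro j
    induction j with
    | zero => simpa using latticeSimplex_card_pos n 0
    | succ j ih =>
      have h1 : ((A : ℝ) + 1) * (latticeSimplex n (j * B)).card
          ≤ A * (latticeSimplex n (j * B + B)).card := by exact_mod_cast h (j * B)
      rw [pow_succ, Nat.succ_mul]
      calc r ^ j * r ≤ (latticeSimplex n (j * B)).card * r := by gcongr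
        _ = ((A : ℝ) + 1) * (latticeSimplex n (j * B)).card / A := by rw [hr]; ring
        _ ≤ _ := by rw [div_le_iff₀ hA']; linarith
  have hpoly : ∀ j : ℕ, 0 < j →
      ((latticeSimplex n (j * B)).card : ℝ) ≤ ((B : ℝ) + 1) ^ n * (j : ℝ) ^ n := by
    intro j hj
    rw [← mul_pow]
    have h1 : (j * B + 1) ^ n ≤ ((B + 1) * j) ^ n := Nat.pow_le_pow_left (by nlinarith) n
    exact_mod_cast (card_latticeSimplex_le n (j * B)).trans h1
  have hlim := tendsto_pow_const_div_const_pow_of_one_lt n hr1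
  have hpos : (0 : ℝ) < 1 / ((B : ℝ) + 1) ^ n := by positivity
  obtain ⟨j, hj, hj0⟩ :=
    ((hlim.eventually (gt_mem_nhds hpos)).and (Filter.eventually_gt_atTop 0)).exists
  have hrj : 0 < r ^ j := by positivity
  rw [div_lt_div_iff₀ hrj (by positivity)] at hj
  have := (hgrow j).trans (hpoly j hj0)
  linarith

/-- Perron's theorem: `n` polynomials of degree at most `m` and a further one of degree at most
`1`, in `n` variables, satisfy an algebraic relation of degree at most `m ^ n` in the last one. -/
theorem exists_algebraic_relation {K : Type*} [Field K] {n m : ℕ} (hm : 0 < m)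
    (f : Fin n → MvPolynomial (Fin n) K) (hf : ∀ i, (f i).totalDegree ≤ m)
    (l : MvPolynomial (Fin n) K) (hl : l.totalDegree ≤ 1) :
    ∃ c : Fin (m ^ n + 1) → MvPolynomial (Fin n) K, c ≠ 0 ∧
      ∑ b, aeval f (c b) * l ^ (b : ℕ) = 0 := by
  -- A dimension count: there are `(m ^ n + 1) * |S|` unknown coefficients and at most `m ^ n *
  -- |latticeSimplex n (T + m ^ n)|` equations. The choice `A = m ^ n` compares these two, and `B =
  -- m ^ n` makes room for the powers of `l`.
  obtain ⟨T, hT⟩ := exists_card_latticeSimplex_add_lt n (m ^ n) (m ^ n) (by positivity)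
  set S := latticeSimplex n T with hS
  set J := latticeSimplex n (m * (T + m ^ n)) with hJ
  let g : S × Fin (m ^ n + 1) → MvPolynomial (Fin n) K :=
    fun ab => (∏ i, f i ^ ab.1.1 i) * l ^ (ab.2 : ℕ)
  have hg : ∀ ab, (g ab).totalDegree ≤ m * (T + m ^ n) := by
    rintro ⟨⟨a, ha⟩, b⟩
    have ha' := mem_latticeSimplex.1 ha
    refine (totalDegree_mul _ _).trans ?_
    have h1 : (∏ i, f i ^ a i).totalDegree ≤ m * T := by
      refine (totalDegree_finsetProd _ _).trans ?_
      calc ∑ i, (f i ^ a i).totalDegree ≤ ∑ i, m * a i := by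
            refine Finset.sum_le_sum fun i _ => (totalDegree_pow _ _).trans ?_
            rw [mul_comm]
            exact Nat.mul_le_mul_right _ (hf i)
        _ = m * ∑ i, a i := by rw [Finset.mul_sum]
        _ ≤ m * T := Nat.mul_le_mul_left _ ha'
    have h2 : (l ^ (b : ℕ)).totalDegree ≤ m * m ^ n := by
      refine (totalDegree_pow _ _).trans ?_
      have := b.2
      calc (b : ℕ) * l.totalDegree ≤ m ^ n * 1 := Nat.mul_le_mul (by omega) hl
        _ ≤ m * m ^ n := by rw [mul_one]; exact Nat.le_mul_of_pos_left _ hm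
    rw [mul_add]
    exact add_le_add h1 h2
  let φ : (S × Fin (m ^ n + 1) → K) →ₗ[K] (J → K) :=
    LinearMap.pi fun j => ∑ ab, (coeff (Finsupp.equivFunOnFinite.symm j.1) (g ab)) •
      LinearMap.proj ab
  have hφ : ∀ x j, φ x j = coeff (Finsupp.equivFunOnFinite.symm j.1) (∑ ab, C (x ab) * g ab) := by
    intro x j
    simp [φ, coeff_sum, coeff_C_mul, mul_comm]
  have hker : LinearMap.ker φ ≠ ⊥ := by
    refine LinearMap.ker_ne_bot_of_finrank_lt ?_
    simp only [Module.finrank_fintype_fun_eq_card, Fintype.card_prod, Fintype.card_coe,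
      Fintype.card_fin]
    have := card_latticeSimplex_mul_le (n := n) hm (T + m ^ n)
    rw [mul_comm S.card]
    exact this.trans_lt hT
  obtain ⟨x, hx, hx0⟩ := (Submodule.ne_bot_iff _).1 hker
  have hzero : ∑ ab, C (x ab) * g ab = 0 := by
    ext s
    rw [coeff_zero]
    by_cases hs : ∑ i, s i ≤ m * (T + m ^ n)
    · have := congrFun (LinearMap.mem_ker.1 hx) ⟨s, mem_latticeSimplex.2 hs⟩
      rw [hφ] at this
      simpa using this
    · refine coeff_eq_zero_of_totalDegree_lt ?_
      have hdeg : (∑ ab, C (x ab) * g ab).totalDegree ≤ m * (T + m ^ n) := by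
        refine totalDegree_finsetSum_le fun ab _ => (totalDegree_mul _ _).trans ?_
        simpa using hg ab
      refine hdeg.trans_lt ?_
      rw [← Finsupp.degree_eq_sum] at hs
      exact not_le.1 hs
  refine ⟨fun b => ∑ a : S, monomial (Finsupp.equivFunOnFinite.symm a.1) (x (a, b)), ?_, ?_⟩
  · intro hc
    refine hx0 (funext fun ⟨a, b⟩ => ?_)
    have := congrArg (coeff (Finsupp.equivFunOnFinite.symm a.1)) (congrFun hc b)
    classical
    simpa [coeff_sum, coeff_monomial, Subtype.val_inj] using this
  · rw [← hzero, Fintype.sum_prod_type_right]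
    refine Finset.sum_congr rfl fun b _ => ?_
    rw [map_sum, Finset.sum_mul]
    refine Finset.sum_congr rfl fun a _ => ?_
    rw [aeval_monomial, Finsupp.prod_fintype _ _ (fun _ => pow_zero _)]
    simp [g, mul_assoc, algebraMap_eq]

/-! ### Persistence of nondegenerate zeros -/

/-- The Jacobian matrix of a polynomial field. -/
noncomputable def PolyField.jacobian {n : ℕ} (F : PolyField n) (x : Fin n → ℂ) :
    Matrix (Fin n) (Fin n) ℂ :=
  Matrix.of fun i j => eval x (pderiv j (F i))

theorem MvPolynomial.hasFDerivAt_eval {n : ℕ} (p : MvPolynomial (Fin n) ℂ) (x : Fin n → ℂ) :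
    HasFDerivAt (fun y : Fin n → ℂ => eval y p)
      (∑ j, eval x (pderiv j p) • (ContinuousLinearMap.proj j : (Fin n → ℂ) →L[ℂ] ℂ)) x := by
  induction p using MvPolynomial.induction_on with
  | C a =>
    simp only [eval_C]
    refine (hasFDerivAt_const a x).congr_fderiv ?_
    ext v
    simp
  | add p q hp hq =>
    simp only [map_add]
    refine (hp.fun_add hq).congr_fderiv ?_
    ext v
    simp [add_mul, Finset.sum_add_distrib]
  | mul_X p i hp =>
    have h := hp.mul (ContinuousLinearMap.proj (R := ℂ) (φ := fun _ : Fin n => ℂ) i).hasFDerivAt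
    simp only [map_mul, eval_X]
    refine h.congr_fderiv ?_
    ext v
    simp [Derivation.leibniz, add_mul, Finset.sum_add_distrib, pderiv_X, Pi.single_apply,
      Finset.mul_sum, apply_ite, ite_mul]
    ring_nf

theorem PolyField.hasFDerivAt_evalAt {n : ℕ} (F : PolyField n) (x : Fin n → ℂ) :
    HasFDerivAt F.evalAt (Matrix.toLin' (F.jacobian x)).toContinuousLinearMap x := by
  refine hasFDerivAt_pi'.2 fun i => ?_
  refine (hasFDerivAt_eval (F i) x).congr_fderiv ?_
  ext v
  simp [PolyField.jacobian, Matrix.mulVec, dotProduct]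

/-- Nondegenerate zeros of polynomial fields persist under perturbation. -/
theorem PolyField.eventually_exists_zero {P : Type*} [NormedAddCommGroup P] [NormedSpace ℂ P]
    [CompleteSpace P] {n : ℕ} (F : P → PolyField n)
    (hF : ContDiff ℂ 1 fun q : P × (Fin n → ℂ) => (F q.1).evalAt q.2)
    {p₀ : P} {x₀ : Fin n → ℂ} (h₀ : (F p₀).evalAt x₀ = 0)
    (hdet : ((F p₀).jacobian x₀).det ≠ 0) {U : Set (P × (Fin n → ℂ))}
    (hU : U ∈ nhds (p₀, x₀)) :
    ∀ᶠ p in nhds p₀, ∃ x, (p, x) ∈ U ∧ (F p).evalAt x = 0 := by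
  set G : P × (Fin n → ℂ) → Fin n → ℂ := fun q => (F q.1).evalAt q.2 with hG
  have hG' : HasStrictFDerivAt G (fderiv ℂ G (p₀, x₀)) (p₀, x₀) :=
    hF.contDiffAt.hasStrictFDerivAt one_ne_zero
  have hpart : ∀ v, fderiv ℂ G (p₀, x₀) (0, v) = ((F p₀).jacobian x₀).mulVec v := by
    intro v
    have h1 := hG'.hasFDerivAt.comp x₀ (hasFDerivAt_prodMk_right p₀ x₀)
    have h2 := h1.unique ((F p₀).hasFDerivAt_evalAt x₀)
    simpa using congrArg (fun L => L v) h2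
  -- The map `(p, x) ↦ (p, G(p, x))` has surjective derivative, so it sends neighbourhoods of `(p₀,
  -- x₀)` to neighbourhoods of `(p₀, 0)`; these contain `(p, 0)` for `p` near `p₀`.
  have hΦ : HasStrictFDerivAt (fun q : P × (Fin n → ℂ) => (q.1, G q))
      ((ContinuousLinearMap.fst ℂ P (Fin n → ℂ)).prod (fderiv ℂ G (p₀, x₀))) (p₀, x₀) :=
    hasStrictFDerivAt_fst.prodMk hG'
  have hsurj : ((ContinuousLinearMap.fst ℂ P (Fin n → ℂ)).prod
      (fderiv ℂ G (p₀, x₀))).range = ⊤ := by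
    refine LinearMap.range_eq_top.2 ?_
    rintro ⟨p, y⟩
    refine ⟨(p, ((F p₀).jacobian x₀)⁻¹.mulVec (y - fderiv ℂ G (p₀, x₀) (p, 0))), ?_⟩
    have hsplit : ∀ v, fderiv ℂ G (p₀, x₀) (p, v)
        = fderiv ℂ G (p₀, x₀) (p, 0) + fderiv ℂ G (p₀, x₀) (0, v) := by
      intro v
      rw [← map_add]
      simp
    have hinv : (F p₀).jacobian x₀ * ((F p₀).jacobian x₀)⁻¹ = 1 :=
      Matrix.mul_nonsing_inv _ (isUnit_iff_ne_zero.2 hdet)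
    simp only [ContinuousLinearMap.coe_coe, ContinuousLinearMap.prod_apply,
      ContinuousLinearMap.coe_fst', Prod.mk.injEq, true_and]
    rw [hsplit, hpart, Matrix.mulVec_mulVec, hinv, Matrix.one_mulVec]
    abel
  have hmap := hΦ.map_nhds_eq_of_surj hsurj
  have himg := Filter.image_mem_map (m := fun q : P × (Fin n → ℂ) => (q.1, G q)) hU
  rw [hmap] at himg
  have hcont : Filter.Tendsto (fun p : P => (p, (0 : Fin n → ℂ))) (nhds p₀)
      (nhds (p₀, G (p₀, x₀))) := by
    have : G (p₀, x₀) = 0 := h₀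
    rw [this]
    exact (Continuous.prodMk_left _).tendsto p₀
  filter_upwards [hcont himg] with p hp
  obtain ⟨⟨p', x⟩, hqU, hq⟩ := hp
  simp only [Prod.mk.injEq] at hq
  obtain ⟨rfl, hq⟩ := hq
  exact ⟨x, hqU, hq⟩

theorem PolyField.contDiff_evalAt {n : ℕ} (F : PolyField n) : ContDiff ℂ 1 F.evalAt := by
  rw [contDiff_pi]
  intro i
  have := AnalyticOnNhd.eval_mvPolynomial (F i)
  exact (this.contDiff).of_le le_top

/-! ### Bézout's bound, and persistence of finite sets of zeros -/

/-- A linear form separating the points of a finite set. -/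
theorem exists_linear_form_injOn {n : ℕ} (S : Finset (Fin n → ℂ)) :
    ∃ a : Fin n → ℂ, Set.InjOn (fun x => ∑ i, a i * x i) (S : Set (Fin n → ℂ)) := by
  classical
  -- As a polynomial in the coefficients of the form, `Q` vanishes exactly when some pair of points
  -- is not separated.
  let Q : MvPolynomial (Fin n) ℂ :=
    ∏ p ∈ S.offDiag, ∑ i, C (p.1 i - p.2 i) * X i
  have hQ : Q ≠ 0 := by
    refine Finset.prod_ne_zero_iff.2 fun p hp h0 => ?_
    obtain ⟨-, -, hne⟩ := Finset.mem_offDiag.1 hp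
    refine hne (funext fun i => sub_eq_zero.1 ?_)
    have := congrArg (eval (Pi.single i (1 : ℂ))) h0
    simpa [Pi.single_apply] using this
  obtain ⟨a, ha⟩ : ∃ a, eval a Q ≠ 0 := by
    by_contra! h
    exact hQ (MvPolynomial.funext fun a => by simpa using h a)
  refine ⟨a, fun x hx y hy hxy => ?_⟩
  by_contra hne
  rw [map_prod, Finset.prod_ne_zero_iff] at ha
  refine ha (x, y) (Finset.mem_offDiag.2 ⟨hx, hy, hne⟩) ?_
  simp only at hxy
  simp only [map_sum, map_mul, eval_C, eval_X, sub_mul, Finset.sum_sub_distrib, sub_eq_zero]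
  simpa [mul_comm] using hxy

/-- Every neighbourhood contains a product of infinite sets, on which only the zero polynomial
vanishes. -/
theorem MvPolynomial.frequently_eval_ne_zero {n : ℕ} {p : MvPolynomial (Fin n) ℂ} (hp : p ≠ 0)
    (x : Fin n → ℂ) : ∃ᶠ y in nhds x, eval y p ≠ 0 := by
  intro h
  simp only [not_not] at h
  rw [nhds_pi, Filter.eventually_iff, Filter.mem_pi'] at h
  obtain ⟨I, t, ht, hsub⟩ := h
  refine hp (funext_set t (fun i => infinite_of_mem_nhds (x i) (ht i)) fun y hy => ?_)
  rw [map_zero]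
  exact hsub fun i _ => hy i (Set.mem_univ i)

/-- Bézout's bound for nondegenerate zeros. -/
theorem PolyField.card_nondegenerate_zeros_le {n m : ℕ} (hm : 0 < m) (F : PolyField n)
    (hF : ∀ i, (F i).totalDegree ≤ m) (S : Finset (Fin n → ℂ))
    (hS : ∀ x ∈ S, F.evalAt x = 0 ∧ (F.jacobian x).det ≠ 0) : S.card ≤ m ^ n := by
  classical
  obtain ⟨a, ha⟩ := exists_linear_form_injOn S
  let l : MvPolynomial (Fin n) ℂ := ∑ i, C (a i) * X i
  have hl : l.totalDegree ≤ 1 := by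
    refine totalDegree_finsetSum_le fun i _ => (totalDegree_mul _ _).trans ?_
    simp
  have hl' : ∀ x, eval x l = ∑ i, a i * x i := by
    intro x
    simp [l]
  obtain ⟨c, hc, hrel⟩ := exists_algebraic_relation hm F hF l hl
  obtain ⟨b₀, hb₀⟩ := Function.ne_iff.1 hc
  -- The values of `l`, rather than the points, are separated: only these must stay distinct after
  -- perturbation.
  obtain ⟨U, hU, hdisj⟩ := (S.image fun x => ∑ i, a i * x i).finite_toSet.t2_separation
  have hpers : ∀ x ∈ S, ∀ᶠ y in nhds (0 : Fin n → ℂ),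
      ∃ z, eval z l ∈ U (∑ i, a i * x i) ∧ F.evalAt z = y := by
    intro x hx
    have hx1 := hU (∑ i, a i * x i)
    have hopen : {q : (Fin n → ℂ) × (Fin n → ℂ) | eval q.2 l ∈ U (∑ i, a i * x i)}
        ∈ nhds ((0 : Fin n → ℂ), x) := by
      have hc : Continuous fun q : (Fin n → ℂ) × (Fin n → ℂ) => eval q.2 l :=
        (MvPolynomial.continuous_eval l).comp continuous_snd
      refine (hx1.2.preimage hc).mem_nhds ?_
      simpa [hl'] using hx1.1
    have heval : ∀ y z, PolyField.evalAt (fun i => F i - C (y i)) z = F.evalAt z - y := by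
      intro y z
      funext i
      simp [PolyField.evalAt]
    have hjac : PolyField.jacobian (fun i => F i - C ((0 : Fin n → ℂ) i)) x = F.jacobian x := by
      ext i j
      simp [PolyField.jacobian]
    have := PolyField.eventually_exists_zero (P := Fin n → ℂ) (fun y i => F i - C (y i))
      (p₀ := 0) (x₀ := x) ?_ ?_ ?_ hopen
    · filter_upwards [this] with y hy
      obtain ⟨z, hz, hz0⟩ := hy
      rw [heval, sub_eq_zero] at hz0
      exact ⟨z, hz, hz0⟩
    · simp only [heval]
      exact (F.contDiff_evalAt.comp contDiff_snd).sub contDiff_fst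
    · rw [heval, (hS x hx).1, sub_zero]
    · rw [hjac]
      exact (hS x hx).2
  -- The coefficients of Perron's relation may all vanish at `0`. A nearby `y` where `c b₀` does not
  -- vanish makes it a nonzero polynomial of degree at most `m ^ n`, with the values of `l` at the
  -- perturbed solutions of `F = y` among its roots.
  obtain ⟨y, hyne, hy⟩ := ((frequently_eval_ne_zero hb₀ 0).and_eventually
    ((Finset.eventually_all S).2 hpers)).exists
  choose! z hzU hzy using hy
  let p : Polynomial ℂ := ∑ b : Fin (m ^ n + 1), Polynomial.monomial (b : ℕ) (eval y (c b))
  have hp0 : p ≠ 0 := by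
    intro h
    have := congrArg (fun q => Polynomial.coeff q (b₀ : ℕ)) h
    refine hyne ?_
    simpa [p, Polynomial.finsetSum_coeff, Polynomial.coeff_monomial, Fin.val_inj] using this
  have hdeg : p.natDegree ≤ m ^ n := by
    refine Polynomial.natDegree_sum_le_of_forall_le _ _ fun b _ => ?_
    exact (Polynomial.natDegree_monomial_le _).trans (Nat.lt_succ_iff.1 b.2)
  have hroot : ∀ x ∈ S, eval (z x) l ∈ p.roots.toFinset := by
    intro x hx
    rw [Multiset.mem_toFinset, Polynomial.mem_roots hp0, Polynomial.IsRoot]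
    have h1 := congrArg (eval (z x)) hrel
    have h2 : ∀ q, eval (z x) (aeval F q) = eval y q := by
      intro q
      rw [← hzy x hx]
      induction q using MvPolynomial.induction_on with
      | C r => simp
      | add q r hq hr => rw [map_add, map_add, hq, hr, map_add]
      | mul_X q i hq => rw [map_mul, map_mul, hq, map_mul, aeval_X, eval_X]; rfl
    rw [← map_zero (eval (z x)), ← h1]
    simp only [map_sum, map_mul, map_pow, h2, p, Polynomial.eval_finsetSum,
      Polynomial.eval_monomial]
  have hinj : Set.InjOn (fun x => eval (z x) l) (S : Set (Fin n → ℂ)) := by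
    intro x hx x' hx' hxx'
    by_contra hne
    have h1 : ∑ i, a i * x i ≠ ∑ i, a i * x' i := fun h => hne (ha hx hx' h)
    have h2 := hdisj (Finset.mem_coe.2 (Finset.mem_image_of_mem _ hx))
      (Finset.mem_coe.2 (Finset.mem_image_of_mem _ hx')) h1
    refine Set.disjoint_left.1 h2 (hzU x hx) ?_
    simp only at hxx'
    rw [hxx']
    exact hzU x' hx'
  calc S.card ≤ p.roots.toFinset.card := Finset.card_le_card_of_injOn _ hroot hinj
    _ ≤ Multiset.card p.roots := Multiset.toFinset_card_le _
    _ ≤ p.natDegree := Polynomial.card_roots' p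
    _ ≤ m ^ n := hdeg

/-- A finite set of nondegenerate zeros of a polynomial field persists under perturbation. -/
theorem PolyField.eventually_exists_zeros {P : Type*} [NormedAddCommGroup P] [NormedSpace ℂ P]
    [CompleteSpace P] {n : ℕ} (F : P → PolyField n)
    (hF : ContDiff ℂ 1 fun q : P × (Fin n → ℂ) => (F q.1).evalAt q.2)
    {p₀ : P} (S : Finset (Fin n → ℂ))
    (hS : ∀ x ∈ S, (F p₀).evalAt x = 0 ∧ ((F p₀).jacobian x).det ≠ 0)
    {O : Set (P × (Fin n → ℂ))} (hO : ∀ x ∈ S, O ∈ nhds (p₀, x)) :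
    ∀ᶠ p in nhds p₀, ∃ S' : Finset (Fin n → ℂ), S'.card = S.card ∧
      ∀ z ∈ S', (p, z) ∈ O ∧ (F p).evalAt z = 0 := by
  classical
  obtain ⟨U, hU, hdisj⟩ := S.finite_toSet.t2_separation
  have hpers : ∀ x ∈ S, ∀ᶠ p in nhds p₀,
      ∃ z, (p, z) ∈ O ∩ Prod.snd ⁻¹' U x ∧ (F p).evalAt z = 0 := fun x hx =>
    PolyField.eventually_exists_zero F hF (hS x hx).1 (hS x hx).2
      (Filter.inter_mem (hO x hx) (((hU x).2.preimage continuous_snd).mem_nhds (hU x).1))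
  filter_upwards [(Finset.eventually_all S).2 hpers] with p hp
  choose! z hz hz0 using hp
  refine ⟨S.image z, Finset.card_image_of_injOn fun x hx y hy hxy => ?_, ?_⟩
  · by_contra hne
    refine Set.disjoint_left.1 (hdisj hx hy hne) (hz x hx).2 ?_
    change z x ∈ U y
    rw [hxy]
    exact (hz y hy).2
  · simp only [Finset.forall_mem_image]
    exact fun x hx => ⟨(hz x hx).1, hz0 x hx⟩

/-! ### Homogeneous fields and their fixed points -/

theorem MvPolynomial.IsHomogeneous.eval_smul {σ R : Type*} [CommSemiring R] {p : MvPolynomial σ R}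
    {m : ℕ} (hp : p.IsHomogeneous m) (a : R) (x : σ → R) :
    eval (a • x) p = a ^ m * eval x p := by
  rw [eval_eq, eval_eq, Finset.mul_sum]
  refine Finset.sum_congr rfl fun s hs => ?_
  have : ∏ j ∈ s.support, a ^ s j = a ^ m := by
    rw [Finset.prod_pow_eq_pow_sum, hp.degree_eq_sum_deg_support hs]
  simp only [Pi.smul_apply, smul_eq_mul, mul_pow, Finset.prod_mul_distrib, this]
  ring

theorem PolyField.evalAt_smul {n m : ℕ} {F : PolyField n} (hF : ∀ i, (F i).IsHomogeneous m)
    (a : ℂ) (x : Fin n → ℂ) : F.evalAt (a • x) = a ^ m • F.evalAt x :=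
  funext fun i => (hF i).eval_smul a x

theorem PolyField.jacobian_smul {n m : ℕ} {F : PolyField n} (hF : ∀ i, (F i).IsHomogeneous m)
    (a : ℂ) (x : Fin n → ℂ) : F.jacobian (a • x) = a ^ (m - 1) • F.jacobian x := by
  ext i j
  exact ((hF i).pderiv).eval_smul a x

/-- The field `F(x) - x`, whose zeros are the fixed points of `F`. -/
noncomputable def PolyField.subId {n : ℕ} (F : PolyField n) : PolyField n := fun i => F i - X i

theorem PolyField.evalAt_subId {n : ℕ} (F : PolyField n) (x : Fin n → ℂ) :
    F.subId.evalAt x = F.evalAt x - x := by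
  funext i
  simp [PolyField.evalAt, PolyField.subId]

theorem PolyField.jacobian_subId {n : ℕ} (F : PolyField n) (x : Fin n → ℂ) :
    F.subId.jacobian x = F.jacobian x - 1 := by
  ext i j
  rcases eq_or_ne i j with rfl | h
  · simp [PolyField.jacobian, PolyField.subId]
  · simp [PolyField.jacobian, PolyField.subId, pderiv_X, h]

theorem PolyField.totalDegree_subId_le {n m : ℕ} (hm : 0 < m) {F : PolyField n}
    (hF : ∀ i, (F i).totalDegree ≤ m) (i : Fin n) : (F.subId i).totalDegree ≤ m := by
  refine (totalDegree_sub _ _).trans (max_le (hF i) ?_)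
  rw [totalDegree_X]
  exact hm

/-- `x` is a fixed point of `F` at which the Kovalevskaya matrix is invertible. -/
def PolyField.IsNondegenerateFixedPoint {n : ℕ} (F : PolyField n) (x : Fin n → ℂ) : Prop :=
  F.evalAt x = x ∧ (F.jacobian x - 1).det ≠ 0

theorem PolyField.card_nondegenerateFixedPoints_le {n m : ℕ} (hm : 0 < m) {F : PolyField n}
    (hF : ∀ i, (F i).totalDegree ≤ m) (S : Finset (Fin n → ℂ))
    (hS : ∀ x ∈ S, F.IsNondegenerateFixedPoint x) : S.card ≤ m ^ n := by
  refine PolyField.card_nondegenerate_zeros_le hm F.subId (totalDegree_subId_le hm hF) S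
    fun x hx => ?_
  rw [evalAt_subId, jacobian_subId, sub_eq_zero]
  exact hS x hx

/-! ### No zeros at infinity -/

/-- `det (A + t B)` is a polynomial in `t` whose coefficient of degree `n` is `det B`, so it is
nonzero; after `t = s ^ r` it still has only finitely many roots. -/
theorem Matrix.eventually_det_add_pow_smul_ne_zero {n : ℕ} (A B : Matrix (Fin n) (Fin n) ℂ)
    (hB : B.det ≠ 0) {r : ℕ} (hr : 0 < r) :
    ∀ᶠ s in nhdsWithin (0 : ℂ) {0}ᶜ, (A + s ^ r • B).det ≠ 0 := by
  let q : Polynomial ℂ :=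
    Matrix.det ((Polynomial.X : Polynomial ℂ) • B.map Polynomial.C + A.map Polynomial.C)
  have hq : q ≠ 0 := by
    intro h
    refine hB ?_
    rw [← Polynomial.coeff_det_X_add_C_card B A]
    change q.coeff _ = 0
    rw [h, Polynomial.coeff_zero]
  have hfin : ((q.comp (Polynomial.X ^ r)).roots.toFinset : Set ℂ).Finite := Finset.finite_toSet _
  have hq' : q.comp (Polynomial.X ^ r) ≠ 0 := by
    rw [← Polynomial.expand_eq_comp_X_pow]
    exact (Polynomial.expand_ne_zero hr).2 hq
  have hnhds : (((q.comp (Polynomial.X ^ r)).roots.toFinset : Set ℂ) \ {0})ᶜ ∈ nhds (0 : ℂ) :=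
    (hfin.subset Set.sdiff_subset).isClosed.isOpen_compl.mem_nhds (by simp)
  filter_upwards [mem_nhdsWithin_of_mem_nhds hnhds, self_mem_nhdsWithin] with s hs hs0 hdet
  refine hs ⟨?_, hs0⟩
  rw [Finset.mem_coe, Multiset.mem_toFinset, Polynomial.mem_roots hq', Polynomial.IsRoot,
    Polynomial.eval_comp, Polynomial.eval_pow, Polynomial.eval_X]
  change Polynomial.eval (s ^ r) (Matrix.det _) = 0
  rw [← Polynomial.coe_evalRingHom, RingHom.map_det, ← hdet]
  congr 1
  ext i j
  simp only [Matrix.smul_apply, Matrix.add_apply, Matrix.map_apply, RingHom.mapMatrix_apply,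
    Polynomial.coe_evalRingHom, Polynomial.eval_add, Polynomial.eval_mul, smul_eq_mul,
    Polynomial.eval_X, Polynomial.eval_C]
  ring

/-- The perturbation `F + s ^ r • (x_j / d_j) ^ m • d`. -/
noncomputable def PolyField.perturbAlong {n : ℕ} (F : PolyField n) (d : Fin n → ℂ) (j : Fin n)
    (m r : ℕ) (s : ℂ) : PolyField n :=
  fun i => F i + C (s ^ r * d i) * (C (d j)⁻¹ * X j) ^ m

section perturbAlong

variable {n : ℕ} (F : PolyField n) (d : Fin n → ℂ) (j : Fin n) (m r : ℕ)

theorem PolyField.evalAt_perturbAlong (s : ℂ) (x : Fin n → ℂ) :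
    (F.perturbAlong d j m r s).evalAt x = F.evalAt x + (s ^ r * ((d j)⁻¹ * x j) ^ m) • d := by
  funext i
  simp only [evalAt, perturbAlong, map_add, map_mul, map_pow, eval_C, eval_X, Pi.add_apply,
    Pi.smul_apply, smul_eq_mul]
  ring

theorem PolyField.jacobian_perturbAlong (s : ℂ) (x : Fin n → ℂ) :
    (F.perturbAlong d j m r s).jacobian x = F.jacobian x +
      (s ^ r * m * ((d j)⁻¹ * x j) ^ (m - 1)) • Matrix.vecMulVec d (Pi.single j (d j)⁻¹) := by
  ext a b
  simp only [jacobian, perturbAlong, Matrix.of_apply, Matrix.add_apply, Matrix.smul_apply,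
    Matrix.vecMulVec_apply, map_add, Derivation.leibniz, Derivation.leibniz_pow, pderiv_C,
    pderiv_X, smul_eq_mul, map_mul, map_pow, eval_C, eval_X, nsmul_eq_mul, map_natCast,
    Pi.single_apply, mul_zero, add_zero]
  rcases eq_or_ne b j with rfl | h
  · simp
    ring
  · simp [h, h.symm]

theorem PolyField.contDiff_evalAt_perturbAlong :
    ContDiff ℂ 1 fun q : ℂ × (Fin n → ℂ) => (F.perturbAlong d j m r q.1).evalAt q.2 := by
  simp only [evalAt_perturbAlong]
  have := F.contDiff_evalAt
  fun_prop

theorem PolyField.continuous_jacobian : Continuous F.jacobian :=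
  continuous_matrix fun i j => MvPolynomial.continuous_eval (pderiv j (F i))

theorem PolyField.continuous_jacobian_perturbAlong :
    Continuous fun q : ℂ × (Fin n → ℂ) => (F.perturbAlong d j m r q.1).jacobian q.2 := by
  simp only [jacobian_perturbAlong]
  have := F.continuous_jacobian
  fun_prop

theorem PolyField.totalDegree_perturbAlong_le (hF : ∀ i, (F i).totalDegree ≤ m) (s : ℂ)
    (i : Fin n) : (F.perturbAlong d j m r s i).totalDegree ≤ m := by
  refine (totalDegree_add _ _).trans (max_le (hF i) ?_)
  refine (totalDegree_mul _ _).trans ?_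
  rw [totalDegree_C, zero_add]
  refine (totalDegree_pow _ _).trans ?_
  have h : (C (d j)⁻¹ * X j : MvPolynomial (Fin n) ℂ).totalDegree ≤ 1 := by
    refine (totalDegree_mul _ _).trans ?_
    simp
  calc m * _ ≤ m * 1 := Nat.mul_le_mul_left _ h
    _ = m := mul_one m

end perturbAlong

/-- A homogeneous field with the maximal number of nondegenerate fixed points vanishes only at
the origin. -/
theorem PolyField.eq_zero_of_evalAt_eq_zero {n m : ℕ} (hm : 2 ≤ m) {F : PolyField n}
    (hF : ∀ i, (F i).IsHomogeneous m) (S : Finset (Fin n → ℂ))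
    (hS : ∀ x ∈ S, F.IsNondegenerateFixedPoint x) (hcard : m ^ n ≤ S.card)
    {d : Fin n → ℂ} (hd : F.evalAt d = 0) : d = 0 := by
  classical
  by_contra hd0
  obtain ⟨j, hj⟩ := Function.ne_iff.1 hd0
  rw [Pi.zero_apply] at hj
  have hm1 : 0 < m - 1 := by omega
  -- With exponent `m - 1`, the point `s⁻¹ • d` is fixed by `G s`: `F(d) = 0` and `s ^ (m - 1) * s⁻¹
  -- ^ m = s⁻¹`. Since `m - 1 > 0`, `G 0` agrees with `F`.
  let G : ℂ → PolyField n := fun s => F.perturbAlong d j m (m - 1) s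
  have hG0 : ∀ x, (G 0).evalAt x = F.evalAt x := fun x => by
    simp [G, evalAt_perturbAlong, hm1.ne']
  have hG0' : ∀ x, (G 0).jacobian x = F.jacobian x := fun x => by
    simp [G, jacobian_perturbAlong, hm1.ne']
  obtain ⟨R, hR⟩ : ∃ R : ℝ, ∀ x ∈ S, ‖x‖ < R :=
    ⟨∑ x ∈ S, ‖x‖ + 1, fun x hx => by
      have := Finset.single_le_sum (f := fun x : Fin n → ℂ => ‖x‖) (fun _ _ => norm_nonneg _) hx
      linarith⟩
  have hpers := PolyField.eventually_exists_zeros (fun s => (G s).subId) (p₀ := 0)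
    (by
      simp only [evalAt_subId]
      exact (F.contDiff_evalAt_perturbAlong d j m (m - 1)).sub contDiff_snd) S
    (fun x hx => by
      rw [evalAt_subId, jacobian_subId, hG0, hG0', sub_eq_zero]
      exact hS x hx)
    (O := {q | ‖q.2‖ < R ∧ ((G q.1).jacobian q.2 - 1).det ≠ 0})
    (fun x hx => by
      have hc1 : Continuous fun q : ℂ × (Fin n → ℂ) => ‖q.2‖ := by fun_prop
      have hc2 : Continuous fun q : ℂ × (Fin n → ℂ) => ((G q.1).jacobian q.2 - 1).det :=
        ((F.continuous_jacobian_perturbAlong d j m (m - 1)).sub continuous_const).matrix_det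
      refine ((isOpen_lt hc1 continuous_const).inter
        (isOpen_ne_fun hc2 continuous_const)).mem_nhds ⟨hR x hx, ?_⟩
      simp only [Set.mem_ofPred_eq, hG0']
      exact (hS x hx).2)
  -- At `s⁻¹ • d` the Kovalevskaya matrix of `G s` is `s⁻¹ ^ (m - 1) • (F'(d) + s ^ (m - 1) • B)`.
  -- The rank-one matrix in `B` is a projection onto the line of `d`, so `B` acts as `m - 1` or `-1`
  -- and is invertible.
  let B : Matrix (Fin n) (Fin n) ℂ := (m : ℂ) • Matrix.vecMulVec d (Pi.single j (d j)⁻¹) - 1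
  have hB : B.det ≠ 0 := by
    intro h
    obtain ⟨v, hv, hBv⟩ := Matrix.exists_mulVec_eq_zero_iff.2 h
    have hv' : ∀ i, m * (d i * ((d j)⁻¹ * v j)) = v i := by
      intro i
      have := congrFun hBv i
      simpa [B, Matrix.sub_mulVec, Matrix.smul_mulVec, Matrix.vecMulVec_mulVec, sub_eq_zero]
        using this
    have hvj : ((m : ℂ) - 1) * v j = 0 := by
      have := hv' j
      rw [mul_inv_cancel_left₀ hj] at this
      linear_combination this
    have hm' : (m : ℂ) - 1 ≠ 0 := by
      rw [sub_ne_zero]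
      exact_mod_cast (by omega : m ≠ 1)
    have hvj0 := (mul_eq_zero.1 hvj).resolve_left hm'
    refine hv (funext fun i => ?_)
    rw [← hv' i, hvj0]
    simp
  have hdet := Matrix.eventually_det_add_pow_smul_ne_zero (F.jacobian d) B hB hm1
  -- This puts `s⁻¹ • d` outside the ball of radius `R` containing the surviving fixed points.
  have hnorm : ∀ᶠ s : ℂ in nhds 0, ‖s‖ * R < ‖d‖ := by
    have hc : Continuous fun s : ℂ => ‖s‖ * R := by fun_prop
    exact (isOpen_lt hc continuous_const).mem_nhds (by simpa using hd0)
  obtain ⟨s, ⟨⟨⟨S', hS'card, hS'⟩, hsR⟩, hsdet⟩, hs0⟩ :=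
    ((((hpers.and hnorm).filter_mono nhdsWithin_le_nhds).and hdet).and
      self_mem_nhdsWithin).exists
  replace hs0 : s ≠ 0 := hs0
  have hpow : s ^ (m - 1) * s⁻¹ ^ (m - 1) = 1 := by
    rw [← mul_pow, mul_inv_cancel₀ hs0, one_pow]
  have hpow' : s ^ (m - 1) * s⁻¹ ^ m = s⁻¹ := by
    obtain ⟨r, rfl⟩ : ∃ r, m = r + 1 := ⟨m - 1, by omega⟩
    rw [pow_succ, ← mul_assoc]
    rw [Nat.add_sub_cancel] at hpow ⊢
    rw [hpow, one_mul]
  have hl : (d j)⁻¹ * (s⁻¹ • d) j = s⁻¹ := by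
    rw [Pi.smul_apply, smul_eq_mul]
    field_simp
  have hnew : (G s).IsNondegenerateFixedPoint (s⁻¹ • d) := by
    constructor
    · rw [evalAt_perturbAlong, hl, hpow', evalAt_smul hF, hd, smul_zero, zero_add]
    · have : (G s).jacobian (s⁻¹ • d) - 1
          = s⁻¹ ^ (m - 1) • (F.jacobian d + s ^ (m - 1) • B) := by
        rw [jacobian_perturbAlong, hl, jacobian_smul hF, smul_add, smul_smul,
          mul_comm _ (s ^ (m - 1)), hpow, one_smul, mul_right_comm, hpow, one_mul]
        simp only [B]
        abel
      rw [this, Matrix.det_smul]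
      exact mul_ne_zero (pow_ne_zero _ (pow_ne_zero _ (inv_ne_zero hs0))) hsdet
  have hnotin : s⁻¹ • d ∉ S' := by
    intro h
    have h1 := (hS' _ h).1.1
    simp only [norm_smul, norm_inv] at h1
    rw [inv_mul_lt_iff₀ (norm_pos_iff.2 hs0)] at h1
    linarith
  have hle := card_nondegenerateFixedPoints_le (by omega : 0 < m) (F := G s)
    (F.totalDegree_perturbAlong_le d j m (m - 1) (fun i => (hF i).totalDegree_le) s)
    (insert (s⁻¹ • d) S') (by
      intro x hx
      rcases Finset.mem_insert.1 hx with rfl | hx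
      · exact hnew
      · obtain ⟨⟨-, h1⟩, h2⟩ := hS' x hx
        rw [evalAt_subId, sub_eq_zero] at h2
        exact ⟨h2, h1⟩)
  rw [Finset.card_insert_of_notMem hnotin] at hle
  omega

/-! ### Darboux points and fixed points -/

theorem Complex.encard_setOf_pow_eq {r : ℕ} (hr : 0 < r) {b : ℂ} (hb : b ≠ 0) :
    {a : ℂ | a ^ r = b}.encard = r := by
  classical
  have hζ := Complex.isPrimitiveRoot_exp r hr.ne'
  have hset : {a : ℂ | a ^ r = b} = ((Polynomial.nthRoots r b).toFinset : Set ℂ) := by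
    ext a
    simp [Polynomial.mem_nthRoots hr]
  rw [hset, Set.encard_coe_eq_coe_finsetCard,
    Multiset.toFinset_card_of_nodup (hζ.nthRoots_nodup hb), hζ.card_nthRoots,
    if_pos (IsAlgClosed.exists_pow_nat_eq b hr)]

theorem gradField_isHomogeneous {n k : ℕ} {V : MvPolynomial (Fin n) ℂ} (hV : V.IsHomogeneous k)
    (i : Fin n) : (gradField V i).IsHomogeneous (k - 1) :=
  hV.pderiv

/-- The nonzero fixed points of the gradient field are the normalised representatives of the
Darboux points, and each Darboux point has `k - 2` of them. -/
theorem encard_nonzero_fixedPoints {n k : ℕ} (hk : 2 < k) {V : MvPolynomial (Fin n) ℂ}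
    (hV : V.IsHomogeneous k) :
    {x : Fin n → ℂ | x ≠ 0 ∧ (gradField V).evalAt x = x}.encard
      = ((k - 2 : ℕ) : ℕ∞) * (gradField V).darbouxPoints.encard := by
  obtain ⟨r, rfl, hr⟩ : ∃ r, k = r + 2 ∧ 0 < r := ⟨k - 2, by omega, by omega⟩
  rw [Nat.add_sub_cancel]
  have hF : ∀ i, (gradField V i).IsHomogeneous (r + 1) := gradField_isHomogeneous hV
  have hrep : ∀ p : ℙ ℂ (Fin n → ℂ), ∃ d, p ∈ (gradField V).darbouxPoints →
      (gradField V).IsNormalisedRep p d := by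
    intro p
    by_cases hp : p ∈ (gradField V).darbouxPoints
    · obtain ⟨d, hd⟩ := exists_isNormalisedRep hk hV hp
      exact ⟨d, fun _ => hd⟩
    · exact ⟨0, fun h => absurd h hp⟩
  choose rep hrep using hrep
  -- Since `F(a x) = a ^ (r + 1) F(x)`, the fixed points on a Darboux line are one representative
  -- times the `r`-th roots of unity, `r = k - 2`.
  have himg : {x : Fin n → ℂ | x ≠ 0 ∧ (gradField V).evalAt x = x}
      = (fun q : ℂ × ℙ ℂ (Fin n → ℂ) => q.1 • rep q.2) ''
        ({a : ℂ | a ^ r = 1} ×ˢ (gradField V).darbouxPoints) := by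
    ext x
    constructor
    · rintro ⟨hx0, hx⟩
      have hp : Projectivization.mk ℂ x hx0 ∈ (gradField V).darbouxPoints :=
        ⟨x, hx0, rfl, hx0, by rwa [hx], 1, by rw [hx, one_smul]⟩
      obtain ⟨hd, hd0, hmk⟩ := hrep _ hp
      obtain ⟨a, ha⟩ := (Projectivization.mk_eq_mk_iff' ℂ _ _ _ _).1 hmk.symm
      refine ⟨(a, Projectivization.mk ℂ x hx0), ⟨?_, hp⟩, ha⟩
      have ha0 : a ≠ 0 := by
        rintro rfl
        exact hx0 (by rw [← ha, zero_smul])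
      rw [← ha, PolyField.evalAt_smul hF, hd] at hx
      have h1 := smul_left_injective ℂ hd0 hx
      simp only [pow_succ] at h1
      exact mul_right_cancel₀ ha0 (h1.trans (one_mul a).symm)
    · rintro ⟨⟨a, p⟩, ⟨ha, hp⟩, rfl⟩
      replace ha : a ^ r = 1 := ha
      obtain ⟨hd, hd0, hmk⟩ := hrep _ hp
      have ha0 : a ≠ 0 := by
        rintro rfl
        rw [zero_pow hr.ne'] at ha
        exact zero_ne_one ha
      refine ⟨smul_ne_zero ha0 hd0, ?_⟩
      simp only
      rw [PolyField.evalAt_smul hF, hd, pow_succ, ha, one_mul]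
  rw [himg, Set.InjOn.encard_image, Set.encard_prod, Complex.encard_setOf_pow_eq hr one_ne_zero]
  rintro ⟨a, p⟩ ⟨ha, hp⟩ ⟨b, q⟩ ⟨hb, hq⟩ hab
  simp only at ha hp hb hq hab
  replace ha : a ^ r = 1 := ha
  obtain ⟨hd, hd0, hmk⟩ := hrep _ hp
  obtain ⟨he, he0, hmk'⟩ := hrep _ hq
  have ha0 : a ≠ 0 := by
    rintro rfl
    rw [zero_pow hr.ne'] at ha
    exact zero_ne_one ha
  have hpq : p = q := by
    rw [← hmk, ← hmk', Projectivization.mk_eq_mk_iff']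
    exact ⟨a⁻¹ * b, by rw [mul_smul, ← hab, inv_smul_smul₀ ha0]⟩
  subst hpq
  rw [smul_left_injective ℂ hd0 hab]

theorem Matrix.forall_mem_roots_charpoly_ne_zero_iff {n : ℕ} (M : Matrix (Fin n) (Fin n) ℂ) :
    (∀ Λ ∈ M.charpoly.roots, Λ ≠ 0) ↔ M.det ≠ 0 := by
  have h : M.charpoly.coeff 0 = 0 ↔ (0 : ℂ) ∈ M.charpoly.roots := by
    rw [Polynomial.mem_roots M.charpoly_monic.ne_zero, Polynomial.IsRoot,
      Polynomial.coeff_zero_eq_eval_zero]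
  rw [Matrix.det_eq_sign_charpoly_coeff, Ne, mul_eq_zero, not_or, h]
  constructor
  · intro h0
    exact ⟨pow_ne_zero _ (by norm_num), fun h1 => h0 0 h1 rfl⟩
  · rintro ⟨-, h1⟩ Λ hΛ rfl
    exact h1 hΛ

/-- Membership in `𝒢_k` in terms of the fixed points of the gradient field. -/
theorem mem_genericPotentials_iff {n k : ℕ} (hk : 2 < k) {V : MvPolynomial (Fin n) ℂ} :
    V ∈ genericPotentials n k ↔ V.IsHomogeneous k ∧
      {x | (gradField V).evalAt x = x}.encard = (((k - 1) ^ n : ℕ) : ℕ∞) ∧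
      ∀ x, (gradField V).evalAt x = x → ((gradField V).jacobian x - 1).det ≠ 0 := by
  refine and_congr_right fun hV => ?_
  have hF := gradField_isHomogeneous hV
  -- The origin is the one extra fixed point: it accounts for the `1` in `(k - 2) * D(n, k - 1) + 1
  -- = (k - 1) ^ n`, and it is always nondegenerate.
  have hzero : (gradField V).evalAt 0 = 0 := by
    have := PolyField.evalAt_smul hF 0 0
    rwa [zero_smul, zero_pow (by omega), zero_smul] at this
  have hjac : (gradField V).jacobian 0 = 0 := by
    have := PolyField.jacobian_smul hF 0 0
    rwa [zero_smul, zero_pow (by omega), zero_smul] at this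
  refine and_congr ?_ ?_
  · have hins : {x | (gradField V).evalAt x = x}
        = insert 0 {x : Fin n → ℂ | x ≠ 0 ∧ (gradField V).evalAt x = x} := by
      ext x
      simp only [Set.mem_ofPred_eq, Set.mem_insert_iff]
      rcases eq_or_ne x 0 with rfl | h
      · simp [hzero]
      · simp [h]
    rw [hins, Set.encard_insert_of_notMem (by simp), encard_nonzero_fixedPoints hk hV]
    have hD := darbouxNumber_mul n (k - 1)
    rw [show k - 1 - 1 = k - 2 by omega] at hD
    have hpos : 0 < (k - 1) ^ n := by
      have : 0 < k - 1 := by omega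
      positivity
    have hk2 : 0 < k - 2 := by omega
    generalize (gradField V).darbouxPoints.encard = e
    induction e using ENat.recTopCoe with
    | top =>
      have h1 : ((k - 2 : ℕ) : ℕ∞) * ⊤ = ⊤ := ENat.mul_top (by exact_mod_cast hk2.ne')
      rw [h1, top_add]
      simp only [ENat.top_ne_natCast]
    | coe e =>
      norm_cast
      constructor
      · rintro rfl
        rw [mul_comm]
        omega
      · intro h
        refine Nat.eq_of_mul_eq_mul_right hk2 ?_
        rw [hD, mul_comm]
        omega
  · constructor
    · intro h x hx
      rcases eq_or_ne x 0 with rfl | hx0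
      · rw [hjac, zero_sub, Matrix.det_neg, Matrix.det_one, mul_one]
        exact pow_ne_zero _ (by norm_num)
      · exact (Matrix.forall_mem_roots_charpoly_ne_zero_iff _).1
          (h (Projectivization.mk ℂ x hx0)
            ⟨x, hx0, rfl, hx0, by rwa [hx], 1, by rw [hx, one_smul]⟩ x ⟨hx, hx0, rfl⟩)
    · rintro h p - d ⟨hd, -⟩
      exact (Matrix.forall_mem_roots_charpoly_ne_zero_iff _).2 (h d hd)

/-! ### The potential `V₀` -/

/-- The fixed-point system decouples into `k a ^ (k - 1) = a`, with `k - 1` solutions per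
coordinate. The Kovalevskaya matrix is diagonal, with entry `-1` where `a = 0` and `k - 2`
elsewhere. -/
theorem sum_X_pow_mem_genericPotentials {n k : ℕ} (hk : 2 < k) :
    (∑ i : Fin n, (X i : MvPolynomial (Fin n) ℂ) ^ k) ∈ genericPotentials n k := by
  obtain ⟨r, rfl, hr⟩ : ∃ r, k = r + 2 ∧ 0 < r := ⟨k - 2, by omega, by omega⟩
  have hk0 : ((r + 2 : ℕ) : ℂ) ≠ 0 := by exact_mod_cast (by omega : r + 2 ≠ 0)
  set V : MvPolynomial (Fin n) ℂ := ∑ i : Fin n, X i ^ (r + 2) with hV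
  have hgrad : ∀ i, gradField V i = C ((r + 2 : ℕ) : ℂ) * X i ^ (r + 1) := by
    intro i
    simp only [gradField, hV, map_sum, Derivation.leibniz_pow, pderiv_X, Pi.single_apply]
    simp
    exact (map_ofNat C 2).symm
  have heval : ∀ x, (gradField V).evalAt x = fun i => ((r + 2 : ℕ) : ℂ) * x i ^ (r + 1) := by
    intro x
    funext i
    simp only [PolyField.evalAt, hgrad, map_mul, map_pow, eval_C, eval_X]
  have hjac : ∀ x, (gradField V).jacobian x - 1
      = Matrix.diagonal fun i => ((r + 2 : ℕ) : ℂ) * (((r + 1 : ℕ) : ℂ) * x i ^ r) - 1 := by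
    intro x
    ext i j
    simp only [PolyField.jacobian, Matrix.sub_apply, Matrix.of_apply, hgrad, Matrix.diagonal_apply,
      Matrix.one_apply, Derivation.leibniz, Derivation.leibniz_pow, pderiv_C, pderiv_X,
      Pi.single_apply]
    rcases eq_or_ne i j with rfl | h
    · simp
    · simp [h]
  rw [mem_genericPotentials_iff hk]
  refine ⟨IsHomogeneous.sum _ _ _ fun i _ => by simpa using (isHomogeneous_X ℂ i).pow (r + 2),
    ?_, ?_⟩
  · have hset : {x | (gradField V).evalAt x = x} = Set.pi Set.univ fun _ : Fin n =>
        {a : ℂ | ((r + 2 : ℕ) : ℂ) * a ^ (r + 1) = a} := by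
      ext x
      simp only [heval, Set.mem_ofPred_eq, _root_.funext_iff, Set.mem_pi, Set.mem_univ, true_imp_iff]
    have hins : {a : ℂ | ((r + 2 : ℕ) : ℂ) * a ^ (r + 1) = a}
        = insert 0 {a : ℂ | a ^ r = ((r + 2 : ℕ) : ℂ)⁻¹} := by
      ext a
      simp only [Set.mem_ofPred_eq, Set.mem_insert_iff]
      rcases eq_or_ne a 0 with rfl | h
      · simp
      · simp only [h, false_or]
        rw [← mul_eq_one_iff_eq_inv₀ hk0, pow_succ, ← mul_assoc, mul_eq_right₀ h, mul_comm]
    rw [hset, Set.encard_pi_eq_prod_encard, hins, Set.encard_insert_of_notMem,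
      Complex.encard_setOf_pow_eq hr (inv_ne_zero hk0)]
    · simp
    · simp only [Set.mem_ofPred_eq, zero_pow hr.ne']
      exact (inv_ne_zero hk0).symm
  · intro x hx
    rw [hjac, Matrix.det_diagonal, Finset.prod_ne_zero_iff]
    intro i _
    have hi := congrFun hx i
    rw [heval] at hi
    simp only at hi
    rcases eq_or_ne (x i) 0 with h | h
    · simp [h, hr.ne']
    · have h1 : ((r + 2 : ℕ) : ℂ) * x i ^ r = 1 := by
        rw [pow_succ, ← mul_assoc, mul_eq_right₀ h] at hi
        exact hi
      have h2 : ((r + 2 : ℕ) : ℂ) * (((r + 1 : ℕ) : ℂ) * x i ^ r) - 1 = r := by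
        push_cast at h1 ⊢
        linear_combination (r + 1 : ℂ) * h1
      rw [h2]
      exact_mod_cast hr.ne'

/-! ### Dependence on the coefficients; openness -/

theorem eval_pderiv_potentialOfCoeffs {n k : ℕ} (v : CoeffSpace n k) (i : Fin n)
    (x : Fin n → ℂ) : eval x (pderiv i (potentialOfCoeffs v))
      = ∑ α, v α * eval x (pderiv i (monomial α.1 1)) := by
  rw [potentialOfCoeffs, map_sum, map_sum]
  refine Finset.sum_congr rfl fun α _ => ?_
  rw [← mul_one (v α), ← C_mul_monomial, pderiv_C_mul, map_mul, eval_C, mul_one]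

theorem contDiff_evalAt_gradField (n k : ℕ) :
    ContDiff ℂ 1 fun q : CoeffSpace n k × (Fin n → ℂ) =>
      (gradField (potentialOfCoeffs q.1)).evalAt q.2 := by
  rw [contDiff_pi]
  intro i
  simp only [PolyField.evalAt, gradField, eval_pderiv_potentialOfCoeffs]
  refine ContDiff.sum fun α _ => ContDiff.mul (by fun_prop) ?_
  exact (contDiff_pi.1 (PolyField.contDiff_evalAt
    (fun i => pderiv i (monomial α.1 1))) i).comp contDiff_snd

theorem continuous_jacobian_gradField (n k : ℕ) :
    Continuous fun q : CoeffSpace n k × (Fin n → ℂ) =>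
      (gradField (potentialOfCoeffs q.1)).jacobian q.2 := by
  refine continuous_matrix fun i j => ?_
  have h : ∀ q : CoeffSpace n k × (Fin n → ℂ),
      (gradField (potentialOfCoeffs q.1)).jacobian q.2 i j
        = ∑ α, q.1 α * eval q.2 (pderiv j (pderiv i (monomial α.1 1))) := by
    intro q
    simp only [PolyField.jacobian, gradField, Matrix.of_apply]
    rw [potentialOfCoeffs, map_sum, map_sum, map_sum]
    refine Finset.sum_congr rfl fun α _ => ?_
    rw [← mul_one (q.1 α), ← C_mul_monomial, pderiv_C_mul, pderiv_C_mul, map_mul, eval_C,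
      mul_one]
  simp only [h]
  refine continuous_finsetSum _ fun α _ => Continuous.mul (by fun_prop) ?_
  exact (MvPolynomial.continuous_eval _).comp continuous_snd

/-- Near a generic potential, all fixed points of the gradient field are nondegenerate. -/
theorem eventually_fixedPoints_nondegenerate {n k : ℕ} (hk : 2 < k) {v : CoeffSpace n k}
    (hv : ∀ x, (gradField (potentialOfCoeffs v)).evalAt x = x →
      ((gradField (potentialOfCoeffs v)).jacobian x - 1).det ≠ 0)
    (hv0 : ∀ x, (gradField (potentialOfCoeffs v)).evalAt x = 0 → x = 0) :
    ∀ᶠ w : CoeffSpace n k in nhds v, ∀ x,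
      (gradField (potentialOfCoeffs w)).evalAt x = x →
        ((gradField (potentialOfCoeffs w)).jacobian x - 1).det ≠ 0 := by
  obtain ⟨r, rfl, hr⟩ : ∃ r, k = r + 2 ∧ 0 < r := ⟨k - 2, by omega, by omega⟩
  have hF : ∀ (w : CoeffSpace n (r + 2)) i,
      (gradField (potentialOfCoeffs w) i).IsHomogeneous (r + 1) := fun w =>
    gradField_isHomogeneous (potentialOfCoeffs_isHomogeneous w)
  have hscale : ∀ (w : CoeffSpace n (r + 2)) (t : ℂ) (x : Fin n → ℂ),
      (gradField (potentialOfCoeffs w)).jacobian (t • x) - t ^ r • 1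
        = t ^ r • ((gradField (potentialOfCoeffs w)).jacobian x - 1) := fun w t x => by
    rw [PolyField.jacobian_smul (hF w), Nat.add_sub_cancel, smul_sub]
  -- Homogenisation: a fixed point `x` becomes the ray of `(u, t) = (t x, t)` with `F(u) = t ^ r u`.
  -- On the compact unit sphere, `t = 0` represents infinity, excluded by `hv0`, and `t ≠ 0` gives
  -- the fixed point `t⁻¹ u`, nondegenerate by `hv`.
  have hev : ∀ᶠ w : CoeffSpace n (r + 2) in nhds v,
      ∀ y ∈ Metric.sphere (0 : (Fin n → ℂ) × ℂ) 1,
        ¬ ((gradField (potentialOfCoeffs w)).evalAt y.1 = y.2 ^ r • y.1 ∧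
          ((gradField (potentialOfCoeffs w)).jacobian y.1 - y.2 ^ r • 1).det = 0) := by
    refine (isCompact_sphere _ _).eventually_forall_of_forall_eventually ?_
    rintro ⟨u, t⟩ hut
    have hclosed : IsClosed {z : CoeffSpace n (r + 2) × ((Fin n → ℂ) × ℂ) |
        (gradField (potentialOfCoeffs z.1)).evalAt z.2.1 = z.2.2 ^ r • z.2.1 ∧
        ((gradField (potentialOfCoeffs z.1)).jacobian z.2.1 - z.2.2 ^ r • 1).det = 0} := by
      have hc : Continuous fun z : CoeffSpace n (r + 2) × ((Fin n → ℂ) × ℂ) => (z.1, z.2.1) := by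
        fun_prop
      have h1 := (contDiff_evalAt_gradField n (r + 2)).continuous.comp hc
      have h2 := (continuous_jacobian_gradField n (r + 2)).comp hc
      have h3 : Continuous fun z : CoeffSpace n (r + 2) × ((Fin n → ℂ) × ℂ) =>
          z.2.2 ^ r • (1 : Matrix (Fin n) (Fin n) ℂ) := by fun_prop
      exact (isClosed_eq h1 (by fun_prop)).inter
        (isClosed_eq (h2.sub h3).matrix_det continuous_const)
    refine hclosed.isOpen_compl.mem_nhds ?_
    rintro ⟨h1, h2⟩
    simp only at h1 h2
    rcases eq_or_ne t 0 with rfl | ht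
    · rw [zero_pow hr.ne', zero_smul] at h1
      rw [hv0 u h1] at hut
      simp at hut
    · have hu : u = t • (t⁻¹ • u) := by rw [smul_inv_smul₀ ht]
      have hfix : (gradField (potentialOfCoeffs v)).evalAt (t⁻¹ • u) = t⁻¹ • u := by
        rw [PolyField.evalAt_smul (hF v), h1, smul_smul, pow_succ, mul_right_comm, ← mul_pow,
          inv_mul_cancel₀ ht, one_pow, one_mul]
      refine hv _ hfix ?_
      rw [hu, hscale, Matrix.det_smul] at h2
      exact (mul_eq_zero.1 h2).resolve_left (pow_ne_zero _ (pow_ne_zero _ ht))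
  filter_upwards [hev] with w hw x hx hdet
  -- Scaling by `1 / max ‖x‖ 1` places `(t x, t)` on the unit sphere of the product sup norm.
  set M : ℝ := max ‖x‖ 1 with hM
  have hM0 : 0 < M := lt_of_lt_of_le one_pos (le_max_right _ _)
  set t : ℂ := ((M⁻¹ : ℝ) : ℂ) with ht
  have htn : ‖t‖ = M⁻¹ := by
    rw [ht, Complex.norm_real, Real.norm_of_nonneg (inv_nonneg.2 hM0.le)]
  refine hw (t • x, t) ?_ ⟨?_, ?_⟩
  · rw [mem_sphere_zero_iff_norm, Prod.norm_mk, norm_smul, htn]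
    rw [← mul_one M⁻¹, mul_assoc, one_mul, ← mul_max_of_nonneg _ _ (inv_nonneg.2 hM0.le), ← hM,
      inv_mul_cancel₀ hM0.ne']
  · simp only
    rw [PolyField.evalAt_smul (hF w), hx, smul_smul, pow_succ]
  · simp only
    rw [hscale, Matrix.det_smul, hdet, mul_zero]

theorem isOpen_genericPotentials {n k : ℕ} (hk : 2 < k) :
    IsOpen {v : CoeffSpace n k | potentialOfCoeffs v ∈ genericPotentials n k} := by
  rw [isOpen_iff_mem_nhds]
  intro v hv
  obtain ⟨hV, hcard, hnd⟩ := (mem_genericPotentials_iff hk).1 hv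
  have hfin := Set.finite_of_encard_eq_coe hcard
  have hS : ∀ x ∈ hfin.toFinset,
      (gradField (potentialOfCoeffs v)).IsNondegenerateFixedPoint x := by
    intro x hx
    rw [Set.Finite.mem_toFinset] at hx
    exact ⟨hx, hnd x hx⟩
  have hScard : hfin.toFinset.card = (k - 1) ^ n := by
    rw [hfin.encard_eq_coe_toFinset_card] at hcard
    exact_mod_cast hcard
  have hzero : ∀ x, (gradField (potentialOfCoeffs v)).evalAt x = 0 → x = 0 := fun x hx =>
    PolyField.eq_zero_of_evalAt_eq_zero (by omega : 2 ≤ k - 1) (gradField_isHomogeneous hV)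
      hfin.toFinset hS hScard.ge hx
  have hpers := PolyField.eventually_exists_zeros (P := CoeffSpace n k)
    (fun w => (gradField (potentialOfCoeffs w)).subId) (p₀ := v)
    (by
      simp only [PolyField.evalAt_subId]
      exact (contDiff_evalAt_gradField n k).sub contDiff_snd) hfin.toFinset
    (fun x hx => by
      rw [PolyField.evalAt_subId, PolyField.jacobian_subId, sub_eq_zero]
      exact hS x hx)
    (O := Set.univ) (fun _ _ => Filter.univ_mem)
  filter_upwards [hpers, eventually_fixedPoints_nondegenerate hk hnd hzero] with w hw hwnd
  obtain ⟨S', hS'card, hS'⟩ := hw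
  have hW := potentialOfCoeffs_isHomogeneous w
  refine (mem_genericPotentials_iff hk).2 ⟨hW, le_antisymm ?_ ?_, hwnd⟩
  · by_contra! hlt
    -- Extracting just `(k - 1) ^ n + 1` fixed points also covers a possibly infinite fixed-point
    -- set.
    obtain ⟨t, htsub, ht⟩ := Set.exists_subset_encard_eq (Order.add_one_le_of_lt hlt)
    have htfin : t.Finite := Set.finite_of_encard_eq_coe (k := (k - 1) ^ n + 1) (by
      rw [ht]; norm_cast)
    have hle := PolyField.card_nondegenerateFixedPoints_le (by omega : 0 < k - 1)
      (fun i => (gradField_isHomogeneous hW i).totalDegree_le) htfin.toFinset (fun x hx => by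
        have := htsub (htfin.mem_toFinset.1 hx)
        exact ⟨this, hwnd x this⟩)
    rw [htfin.encard_eq_coe_toFinset_card] at ht
    have ht' : htfin.toFinset.card = (k - 1) ^ n + 1 := by exact_mod_cast ht
    omega
  · rw [← hScard, ← hS'card, ← Set.encard_coe_eq_coe_finsetCard]
    refine Set.encard_le_encard fun z hz => ?_
    have := (hS' z hz).2
    rwa [PolyField.evalAt_subId, sub_eq_zero] at this

/-! ### Arbitrary norms -/

/-- On a finite-dimensional space, an open set is open with respect to every norm. -/
theorem IsOpen.exists_seminorm_ball_subset {E : Type*} [NormedAddCommGroup E] [NormedSpace ℂ E]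
    [FiniteDimensional ℂ E] {O : Set E} (hO : IsOpen O) (N : Seminorm ℂ E)
    (hN : ∀ v, N v = 0 → v = 0) {v : E} (hv : v ∈ O) :
    ∃ ε : ℝ, 0 < ε ∧ ∀ w, N (w - v) < ε → w ∈ O := by
  have : FiniteDimensional ℝ E := FiniteDimensional.complexToReal E
  have : ProperSpace E := FiniteDimensional.proper ℂ E
  have hcont : Continuous N := N.convexOn.locallyLipschitz.continuous
  obtain ⟨δ, hδ, hball⟩ := Metric.isOpen_iff.1 hO v hv
  -- The sphere is empty only when `E` is trivial; otherwise the minimum of `N` on it is positive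
  -- and bounds the given norm by a multiple of `N`.
  rcases (Metric.sphere (0 : E) 1).eq_empty_or_nonempty with hemp | hne
  · refine ⟨1, one_pos, fun w _ => ?_⟩
    have hwv : w - v = 0 := by
      by_contra h
      have : ((‖w - v‖⁻¹ : ℝ) : ℂ) • (w - v) ∈ Metric.sphere (0 : E) 1 := by
        simp [norm_smul, norm_ne_zero_iff.2 h]
      rw [hemp] at this
      exact this
    rwa [sub_eq_zero.1 hwv]
  · obtain ⟨x₀, hx₀, hmin⟩ := (isCompact_sphere (0 : E) 1).exists_isMinOn hne hcont.continuousOn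
    have hpos : 0 < N x₀ := by
      refine lt_of_le_of_ne (apply_nonneg N x₀) fun h => ?_
      rw [hN x₀ h.symm] at hx₀
      simp at hx₀
    refine ⟨N x₀ * δ, by positivity, fun w hw => hball ?_⟩
    rw [Metric.mem_ball, dist_eq_norm]
    rcases eq_or_ne (w - v) 0 with h | h
    · rwa [h, norm_zero]
    · have hn : 0 < ‖w - v‖ := norm_pos_iff.2 h
      have h1 : N x₀ ≤ N (((‖w - v‖⁻¹ : ℝ) : ℂ) • (w - v)) := hmin (by
        simp [norm_smul, hn.ne'])
      rw [map_smul_eq_mul, Complex.norm_real, norm_inv, norm_norm, le_inv_mul_iff₀ hn] at h1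
      have h2 := h1.trans_lt hw
      rw [mul_comm] at h2
      exact lt_of_mul_lt_mul_left h2 hpos.le

theorem mainTheorem3 (n k : ℕ) (hk : 2 < k) :
    (∑ i : Fin n, (MvPolynomial.X i : MvPolynomial (Fin n) ℂ) ^ k) ∈ genericPotentials n k ∧
    IsOpen {v : CoeffSpace n k | potentialOfCoeffs v ∈ genericPotentials n k} ∧
    (∀ N : Seminorm ℂ (CoeffSpace n k), (∀ v, N v = 0 → v = 0) →
      ∀ v : CoeffSpace n k, potentialOfCoeffs v ∈ genericPotentials n k →
        ∃ ε : ℝ, 0 < ε ∧ ∀ w : CoeffSpace n k, N (w - v) < ε →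
          potentialOfCoeffs w ∈ genericPotentials n k) :=
  ⟨sum_X_pow_mem_genericPotentials hk, isOpen_genericPotentials hk, fun N hN _ hv =>
    (isOpen_genericPotentials hk).exists_seminorm_ball_subset N hN hv⟩
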